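/- Let $\mathcal H$ be a finite-dimensional complex Hilbert space and $\mathcal A$ the algebra of all linear operators on $\mathcal H$. Let $h_1,\dots,h_s\in\mathcal A$ be selfadjoint and traceless, and let $b_1,\dots,b_r\in\mathcal A$ (the perturbing operators) be linearly independent with $\mathrm{span}(b_1,\dots,b_r)=\mathrm{span}(b_1^*,\dots,b_r^*)$ (complex spans). Let $h=\sum_{\alpha=1}^s y_\alpha h_\alpha$ with $y\in\mathbb R^s$ and $h\neq 0$, let $T>0$, and let $\omega(a)=\mathrm{tr}(\rho a)$, $\rho=e^{-h/T}/\mathrm{tr}(e^{-h/T})$, be the Gibbs state of $h$ at temperature $T$. Consider the following algorithm. Choose $a_1,\dots,a_r\in\mathrm{span}(b_1,\dots,b_r)$ with $\omega(a_i^*a_j)=\delta_{ij}$. For $k\in\mathcal A$ let $\boldsymbol H(k)$ be the $r\times r$ matrix with entries $\boldsymbol H(k)_{ij}=\omega(a_i^*[k,a_j])$, write $\boldsymbol H_\alpha=\boldsymbol H(h_\alpha)$, and let $W$ be the real $s\times s$ matrix $W_{\alpha\beta}=\mathrm{tr}\big((\boldsymbol H_\alpha^\dagger-\boldsymbol H_\alpha)(\boldsymbol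 H_\beta-\boldsymbol H_\beta^\dagger)\big)$. If $W$ is invertible the algorithm terminates. Otherwise choose a basis $x^{(1)},\dots,x^{(q)}$ of $\ker W\subseteq\mathbb R^s$, put $\tilde h_\beta=\sum_\alpha x^{(\beta)}_\alpha h_\alpha$ and $\boldsymbol\Delta_{ij}=\omega(a_ja_i^*)$, and solve the semidefinite program $$\text{maximize } \mu \text{ over } \tilde y\in\mathbb R^q,\ T'\ge 0,\ \mu\in\mathbb R\quad\text{subject to}\quad T'\log(\boldsymbol\Delta)+\sum_{\beta=1}^q\tilde y_\beta\,\boldsymbol H(\tilde h_\beta)-\mu I\succeq 0,\qquad \sum_{\beta=1}^q\tilde y_\beta\,\omega(\tilde h_\beta)=-1.$$ A triple $(h',T',\mu)$ is called a feasible point of the program if $h'=\sum_\beta\tilde y_\beta\tilde h_\beta$ for a feasible $(\tilde y,T',\mu)$, and an output of the program if $h'=\sum_\beta\tilde y_\beta\tilde h_\beta$ for an optimal $(\tilde y,T',\mu)$. Then, for all choices of the $a_i$ and of the basis of $\ker W$: the matrix $W$ is not invertible, $c:=-\omega(h)$ is a positive real number, $\omega$ is also the Gibbs state of $h/c$ at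 temperature $T/c$, and the following hold. (i) (Feasibility) The triple $(h/c,\,T/c,\,0)$ is a feasible point of the program. In particular the optimal value of the program is $\ge 0$, and $\mu^*\ge 0$ for every output $(h^*,T^*,\mu^*)$. (ii) (Recoverability) If $b_1,\dots,b_r$ span $\mathcal A$, then the program has exactly one output $(h^*,T^*,\mu^*)$, namely $(h/c,\,T/c,\,0)$. In particular, if $h$ and $T$ are scaled so that $\omega(h)=-1$, then $(h,T,0)$ is a feasible point, and it is the only output if $b_1,\dots,b_r$ span $\mathcal A$. -/

import Mathlib

open scoped ComplexOrder

noncomputable section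

namespace HamiltonianLearning

/-- The algebra `𝒜` of all linear operators on the finite-dimensional Hilbert space `E`;
`star` is the adjoint. -/
abbrev Op (E : Type*) [NormedAddCommGroup E] [InnerProductSpace ℂ E] : Type _ := E →L[ℂ] E

section Operators

variable {E : Type*} [NormedAddCommGroup E] [InnerProductSpace ℂ E]

/-- The trace of an operator on `E`. -/
def opTrace (a : Op E) : ℂ := LinearMap.trace ℂ E (a : E →ₗ[ℂ] E)

/-- The commutator `[a, b] = a b - b a`. -/
def comm (a b : Op E) : Op E := a * b - b * a

/-- The Gibbs density matrix `e^{-h/T} / tr (e^{-h/T})`. -/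
def gibbsDensity (h : Op E) (T : ℝ) : Op E :=
  (opTrace (NormedSpace.exp (-(T⁻¹ • h))))⁻¹ • NormedSpace.exp (-(T⁻¹ • h))

/-- `ω` is the Gibbs state `a ↦ tr (ρ a)`, `ρ = e^{-h/T} / tr (e^{-h/T})`, of `h` at the
temperature `T > 0`. -/
def IsGibbsState (ω : Op E →ₗ[ℂ] ℂ) (h : Op E) (T : ℝ) : Prop :=
  0 < T ∧ ∀ a : Op E, ω a = opTrace (gibbsDensity h T * a)

end Operators

section Algorithm

variable {E : Type*} [NormedAddCommGroup E] [InnerProductSpace ℂ E] [CompleteSpace E]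
variable {s r q : ℕ}

/-- Step 1: `a₁, …, a_r` lie in the span of `b₁, …, b_r` and `ω (aᵢ* aⱼ) = δᵢⱼ`. -/
def IsOrthonormalization (ω : Op E →ₗ[ℂ] ℂ) (b a : Fin r → Op E) : Prop :=
  (∀ i, a i ∈ Submodule.span ℂ (Set.range b)) ∧
    ∀ i j, ω (star (a i) * a j) = if i = j then 1 else 0

/-- The `r × r` matrix with entries `ω (aᵢ* [h, aⱼ])`. -/
def commMatrix (ω : Op E →ₗ[ℂ] ℂ) (a : Fin r → Op E) (h : Op E) : Matrix (Fin r) (Fin r) ℂ :=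
  Matrix.of fun i j => ω (star (a i) * comm h (a j))

/-- Step 2: the `s × s` matrix `W α β = tr ((H_α† - H_α) (H_β - H_β†))`. -/
def wMatrix (ω : Op E →ₗ[ℂ] ℂ) (a : Fin r → Op E) (hs : Fin s → Op E) :
    Matrix (Fin s) (Fin s) ℂ :=
  Matrix.of fun α β =>
    (((commMatrix ω a (hs α)).conjTranspose - commMatrix ω a (hs α)) *
      (commMatrix ω a (hs β) - (commMatrix ω a (hs β)).conjTranspose)).trace

/-- The kernel of `W` in `ℝ^s` (the matrix `W` has real entries). -/
def wKernel (ω : Op E →ₗ[ℂ] ℂ) (a : Fin r → Op E) (hs : Fin s → Op E) :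
    Submodule ℝ (Fin s → ℝ) where
  carrier := {x | (wMatrix ω a hs).mulVec (fun α => (x α : ℂ)) = 0}
  zero_mem' := by
    ext i
    simp [Matrix.mulVec, dotProduct]
  add_mem' := by
    intro x y hx hy
    have hxy : (fun α => (((x + y) α : ℝ) : ℂ)) =
        (fun α => (x α : ℂ)) + fun α => (y α : ℂ) := by
      ext α
      simp
    simp only [Set.mem_ofPred_eq] at hx hy ⊢
    rw [hxy, Matrix.mulVec_add, hx, hy, add_zero]
  smul_mem' := by
    intro c x hx
    have hcx : (fun α => (((c • x) α : ℝ) : ℂ)) = (c : ℂ) • fun α => (x α : ℂ) := by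
      ext α
      simp
    simp only [Set.mem_ofPred_eq] at hx ⊢
    rw [hcx, Matrix.mulVec_smul, hx, smul_zero]

/-- The operators `h̃₁, …, h̃_q` given by a basis of the kernel of `W`: the coefficient vector `x`
stands for `∑ α, x α • h_α`. -/
def kernelOperators (ω : Op E →ₗ[ℂ] ℂ) (a : Fin r → Op E) (hs : Fin s → Op E)
    (k : Module.Basis (Fin q) ℝ (wKernel ω a hs)) : Fin q → Op E :=
  fun β => ∑ α, (k β : Fin s → ℝ) α • hs α

/-- Step 3: the `r × r` matrix with entries `ω (aⱼ aᵢ*)`. -/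
def deltaMatrix (ω : Op E →ₗ[ℂ] ℂ) (a : Fin r → Op E) : Matrix (Fin r) (Fin r) ℂ :=
  Matrix.of fun i j => ω (a j * star (a i))

/-- `(y, T, μ)` with `T ≥ 0` satisfies the two constraints
`T log Δ + ∑ β, y β H̃_β - μ I ⪰ 0` and `∑ β, y β ω(h̃_β) = -1` of the semidefinite program. -/
def IsFeasible (ω : Op E →ₗ[ℂ] ℂ) (a : Fin r → Op E) (ht : Fin q → Op E)
    (y : Fin q → ℝ) (T μ : ℝ) : Prop :=
  0 ≤ T ∧
  (T • cfc Real.log (deltaMatrix ω a) + ∑ β, y β • commMatrix ω a (ht β)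
      - μ • (1 : Matrix (Fin r) (Fin r) ℂ)).PosSemidef ∧
  ∑ β, (y β : ℂ) * ω (ht β) = -1

/-- `(y, T, μ)` is an optimal point of the semidefinite program: it is feasible, and `μ` is
maximal among all feasible points. -/
def IsOptimal (ω : Op E →ₗ[ℂ] ℂ) (a : Fin r → Op E) (ht : Fin q → Op E)
    (y : Fin q → ℝ) (T μ : ℝ) : Prop :=
  IsFeasible ω a ht y T μ ∧ ∀ y' T' μ', IsFeasible ω a ht y' T' μ' → μ' ≤ μ

/-- The triple `(h, T, μ)` is a feasible point: `h = ∑ β, y β h̃_β` for a feasible `(y, T, μ)`. -/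
def IsFeasibleTriple (ω : Op E →ₗ[ℂ] ℂ) (a : Fin r → Op E) (ht : Fin q → Op E)
    (h : Op E) (T μ : ℝ) : Prop :=
  ∃ y : Fin q → ℝ, h = ∑ β, y β • ht β ∧ IsFeasible ω a ht y T μ

/-- The triple `(h, T, μ)` is a possible output of the semidefinite program:
`h = ∑ β, y β h̃_β` for an optimal `(y, T, μ)`. -/
def IsOutput (ω : Op E →ₗ[ℂ] ℂ) (a : Fin r → Op E) (ht : Fin q → Op E)
    (h : Op E) (T μ : ℝ) : Prop :=
  ∃ y : Fin q → ℝ, h = ∑ β, y β • ht β ∧ IsOptimal ω a ht y T μ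

/-- The optimal value of the semidefinite program, as a supremum in `[-∞, ∞]`. -/
def optimalValue (ω : Op E →ₗ[ℂ] ℂ) (a : Fin r → Op E) (ht : Fin q → Op E) : EReal :=
  sSup {v : EReal | ∃ (y : Fin q → ℝ) (T μ : ℝ), IsFeasible ω a ht y T μ ∧ v = (μ : EReal)}

end Algorithm

end HamiltonianLearning

end

open HamiltonianLearning

/-!
Let `ρ` be the density matrix of the Gibbs state `ω` of `h` at temperature `T`, and let
`⟪a, b⟫ = ω (a* b)` be the GNS inner product on the algebra of operators. The compressions to
`span (a₁, …, a_r)` of the modular operator `x ↦ ρ x ρ⁻¹` and of `ad k : x ↦ [k, x]` are exactly `Δ`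
and `H(k)`. On the whole algebra `T log (ρ · ρ⁻¹) = -ad h`.

*Feasibility.* The compression of `log` of a positive operator is at most `log` of its compression
(`posSemidef_cfc_log_compression_sub`), so `T log Δ + H(h) ⪰ 0` (`gibbs_posSemidef`). Moreover
`ad h` is symmetric for the GNS inner product because `ρ` commutes with `h`; hence `H(h)` is
Hermitian and the coefficients of `h` lie in the kernel of `W` (`wMatrix_mulVec_eq_zero`). Finally
`ω h < 0`, because `h` is traceless and nonzero and `ρ` is a decreasing function of it, so that
`h` can be normalized to `ω h = -1`.

*Recoverability.* If the perturbing operators span the algebra, nothing is lost in the compression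
and `T log Δ = -H(h)` exactly. The constraint for `(h', T', μ)` becomes `H(k) - μ ⪰ 0` with
`k = h' - (T' / T) h`. As `ad k` has trace zero, `μ ≤ 0`; if `μ = 0`, then `H(k)` is positive of
trace zero, so `ad k = 0`, and the traceless operator `k` vanishes. The normalization then forces
`T' = T` (`nonpos_and_eq_of_isFeasible`).

All of this is carried out in coordinates: with an orthonormal eigenbasis `e` of `h` and
the eigenvalues `p n` of `ρ`, an operator `x` is the vector with components
`√(p n) * ⟪e m, x (e n)⟫`, which turns the GNS inner product into the standard one and makes the
modular operator and `ad h` diagonal.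
-/

namespace HamiltonianLearning

/-! ### Compressions and the logarithm -/

section LogCompression

open Matrix

variable {ι n : Type*} [Fintype ι] [Fintype n]

/-- The inverse is operator convex under compression: `(Xᴴ D X + t)⁻¹ ≤ Xᴴ (D + t)⁻¹ X` for an
isometry `X`, tested on one vector. -/
theorem sum_normSq_div_add_le_of_compression [DecidableEq ι] [DecidableEq n] {X : Matrix ι n ℂ}
    {d : ι → ℝ} {δ : n → ℝ}
    (hX : Xᴴ * X = 1) (hδ : Xᴴ * diagonal (fun i => (d i : ℂ)) * X = diagonal fun k => (δ k : ℂ))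
    {t : ℝ} (hd : ∀ i, 0 < d i + t) (hδt : ∀ k, 0 < δ k + t) (u : n → ℂ) :
    ∑ k, Complex.normSq (u k) / (δ k + t) ≤
      ∑ i, Complex.normSq ((X *ᵥ u) i) / (d i + t) := by
  set w : n → ℂ := fun k => u k / ((δ k + t : ℝ) : ℂ) with hw
  have hδ' : Xᴴ * diagonal (fun i => ((d i + t : ℝ) : ℂ)) * X =
      diagonal fun k => ((δ k + t : ℝ) : ℂ) := by
    have h1 : diagonal (fun i => ((d i + t : ℝ) : ℂ)) =
        diagonal (fun i => (d i : ℂ)) + (t : ℂ) • (1 : Matrix ι ι ℂ) := by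
      rw [smul_one_eq_diagonal, diagonal_add]; simp
    have h2 : diagonal (fun i => ((δ i + t : ℝ) : ℂ)) =
        diagonal (fun i => (δ i : ℂ)) + (t : ℂ) • (1 : Matrix n n ℂ) := by
      rw [smul_one_eq_diagonal, diagonal_add]; simp
    rw [h1, h2, Matrix.mul_add, Matrix.add_mul, hδ]
    simp [hX]
  have e1 : star (X *ᵥ w) ⬝ᵥ (X *ᵥ u) = ((∑ k, Complex.normSq (u k) / (δ k + t) : ℝ) : ℂ) := by
    rw [star_mulVec, dotProduct_mulVec, vecMul_vecMul, hX, vecMul_one, dotProduct]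
    push_cast
    refine Finset.sum_congr rfl fun k _ => ?_
    simp only [hw, Pi.star_apply, Complex.normSq_eq_conj_mul_self, RCLike.star_def, map_div₀,
      Complex.conj_ofReal]
    push_cast
    ring
  have e2 : star (X *ᵥ w) ⬝ᵥ (diagonal (fun i => ((d i + t : ℝ) : ℂ)) *ᵥ (X *ᵥ w)) =
      ((∑ k, Complex.normSq (u k) / (δ k + t) : ℝ) : ℂ) := by
    rw [mulVec_mulVec, star_mulVec, dotProduct_mulVec, vecMul_vecMul, ← Matrix.mul_assoc, hδ',
      ← dotProduct_mulVec, dotProduct]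
    push_cast
    refine Finset.sum_congr rfl fun k _ => ?_
    have := (hδt k).ne'
    have h3 : ((δ k : ℂ) + t) ≠ 0 := by exact_mod_cast this
    simp only [hw, Pi.star_apply, Complex.normSq_eq_conj_mul_self, RCLike.star_def, map_div₀,
      Complex.conj_ofReal, mulVec_diagonal]
    push_cast
    field_simp
  have e1' := congrArg Complex.re e1
  have e2' := congrArg Complex.re e2
  rw [Complex.ofReal_re, dotProduct, Complex.re_sum] at e1' e2'
  -- Complete the square: with `w = (δ + t)⁻¹ u`, the nonnegative quantity
  -- `‖(D + t)^{-1/2} (X u - (D + t) X w)‖²` is the difference of the two sides.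
  have key : 0 ≤ ∑ i, Complex.normSq ((X *ᵥ u) i - ((d i + t : ℝ) : ℂ) * (X *ᵥ w) i) / (d i + t) :=
    Finset.sum_nonneg fun i _ => div_nonneg (Complex.normSq_nonneg _) (hd i).le
  have expand : ∑ i, Complex.normSq ((X *ᵥ u) i - ((d i + t : ℝ) : ℂ) * (X *ᵥ w) i) / (d i + t) =
      ∑ i, Complex.normSq ((X *ᵥ u) i) / (d i + t)
        - 2 * ∑ i, (star (X *ᵥ w) i * (X *ᵥ u) i).re
        + ∑ i, (star (X *ᵥ w) i *
            (diagonal (fun i => ((d i + t : ℝ) : ℂ)) *ᵥ (X *ᵥ w)) i).re := by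
    rw [Finset.mul_sum, ← Finset.sum_sub_distrib, ← Finset.sum_add_distrib]
    refine Finset.sum_congr rfl fun i _ => ?_
    have h0 := (hd i).ne'
    generalize (X *ᵥ u) i = p
    rw [mulVec_diagonal]
    simp only [Pi.star_apply]
    generalize (X *ᵥ w) i = z
    simp only [Complex.normSq_apply, Complex.sub_re, Complex.sub_im, Complex.mul_re,
      Complex.mul_im, Complex.ofReal_re, Complex.ofReal_im, RCLike.star_def, Complex.conj_re,
      Complex.conj_im]
    field_simp
    ring
  rw [expand, e1', e2'] at key
  linarith

/-- Operator Jensen inequality for the logarithm, tested on one vector. The difference of the two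
sides with `d + t` and `δ + t` in place of `d` and `δ` is antitone in `t ≥ 0`, by the inequality for
the inverse, and tends to `0` as `t → ∞`. -/
theorem sum_normSq_mul_log_le_of_compression [DecidableEq ι] [DecidableEq n] {X : Matrix ι n ℂ}
    {d : ι → ℝ} {δ : n → ℝ}
    (hX : Xᴴ * X = 1) (hδ : Xᴴ * diagonal (fun i => (d i : ℂ)) * X = diagonal fun k => (δ k : ℂ))
    (hd : ∀ i, 0 < d i) (hδ0 : ∀ k, 0 < δ k) (u : n → ℂ) :
    ∑ i, Complex.normSq ((X *ᵥ u) i) * Real.log (d i) ≤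
      ∑ k, Complex.normSq (u k) * Real.log (δ k) := by
  set F : ℝ → ℝ := fun t => ∑ k, Complex.normSq (u k) * Real.log (δ k + t) -
      ∑ i, Complex.normSq ((X *ᵥ u) i) * Real.log (d i + t) with hF
  have hnorm : ∑ k, Complex.normSq (u k) = ∑ i, Complex.normSq ((X *ᵥ u) i) := by
    have h1 : star (X *ᵥ u) ⬝ᵥ (X *ᵥ u) = star u ⬝ᵥ u := by
      rw [star_mulVec, dotProduct_mulVec, vecMul_vecMul, hX, vecMul_one]
    simp only [dotProduct, Pi.star_apply, RCLike.star_def,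
      ← Complex.normSq_eq_conj_mul_self] at h1
    exact_mod_cast h1.symm
  have hderiv : ∀ t, 0 ≤ t → HasDerivAt F
      (∑ k, Complex.normSq (u k) * (1 / (δ k + t)) -
        ∑ i, Complex.normSq ((X *ᵥ u) i) * (1 / (d i + t))) t := by
    intro t ht
    refine HasDerivAt.sub (HasDerivAt.fun_sum fun k _ => ?_) (HasDerivAt.fun_sum fun k _ => ?_)
    · exact (((hasDerivAt_id t).const_add (δ k)).log
        (add_pos_of_pos_of_nonneg (hδ0 k) ht).ne').const_mul _
    · exact (((hasDerivAt_id t).const_add (d k)).log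
        (add_pos_of_pos_of_nonneg (hd k) ht).ne').const_mul _
  have hanti : AntitoneOn F (Set.Ici 0) := by
    refine antitoneOn_of_deriv_nonpos (convex_Ici 0)
      (fun t ht => (hderiv t ht).continuousAt.continuousWithinAt) ?_ ?_
    · intro t ht
      rw [interior_Ici] at ht
      exact (hderiv t (le_of_lt ht)).differentiableAt.differentiableWithinAt
    · intro t ht
      rw [interior_Ici] at ht
      have ht' : 0 < t := ht
      rw [(hderiv t ht'.le).deriv, sub_nonpos]
      simpa [div_eq_mul_inv] using sum_normSq_div_add_le_of_compression hX hδ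
        (fun i => add_pos (hd i) ht') (fun k => add_pos (hδ0 k) ht') u
  -- Subtracting `log t` from each logarithm changes nothing, since both weights have the same sum.
  have hlog : ∀ c : ℝ, Filter.Tendsto (fun t : ℝ => Real.log (c + t) - Real.log t)
      Filter.atTop (nhds 0) := by
    intro c
    simpa only [add_comm c] using Real.tendsto_log_comp_add_sub_log c
  have hlim : Filter.Tendsto F Filter.atTop (nhds 0) := by
    have h1 : Filter.Tendsto (fun t : ℝ =>
        ∑ k, Complex.normSq (u k) * (Real.log (δ k + t) - Real.log t) -
        ∑ i, Complex.normSq ((X *ᵥ u) i) * (Real.log (d i + t) - Real.log t))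
        Filter.atTop (nhds (∑ k, Complex.normSq (u k) * 0 -
          ∑ i, Complex.normSq ((X *ᵥ u) i) * 0)) :=
      (tendsto_finsetSum _ fun k _ => (hlog _).const_mul _).sub
        (tendsto_finsetSum _ fun k _ => (hlog _).const_mul _)
    simp only [mul_zero, Finset.sum_const_zero, sub_zero] at h1
    refine h1.congr fun t => ?_
    simp only [hF, mul_sub, Finset.sum_sub_distrib, ← Finset.sum_mul, hnorm]
    ring
  have h0 : 0 ≤ F 0 := by
    refine le_of_tendsto hlim ?_
    filter_upwards [Filter.eventually_ge_atTop 0] with t ht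
    exact hanti (Set.mem_Ici.2 le_rfl) ht ht
  simpa [hF] using h0

/-- Spectral theorem: one unitary diagonalizes a Hermitian matrix and all its functions. -/
theorem exists_unitary_cfc_eq [DecidableEq n] {A : Matrix n n ℂ} (hA : A.IsHermitian) :
    ∃ (U : Matrix n n ℂ) (δ : n → ℝ), Uᴴ * U = 1 ∧ U * Uᴴ = 1 ∧
      Uᴴ * A * U = diagonal (fun k => (δ k : ℂ)) ∧
      ∀ f : ℝ → ℝ, Uᴴ * cfc f A * U = diagonal fun k => (f (δ k) : ℂ) := by
  have h1 : (hA.eigenvectorUnitary : Matrix n n ℂ)ᴴ * hA.eigenvectorUnitary = 1 :=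
    Unitary.coe_star_mul_self hA.eigenvectorUnitary
  have h2 : (hA.eigenvectorUnitary : Matrix n n ℂ) * (hA.eigenvectorUnitary : Matrix n n ℂ)ᴴ = 1 :=
    Unitary.coe_mul_star_self hA.eigenvectorUnitary
  have h3 : ∀ D : Matrix n n ℂ, (hA.eigenvectorUnitary : Matrix n n ℂ)ᴴ *
      (Unitary.conjStarAlgAut ℂ _ hA.eigenvectorUnitary D) * hA.eigenvectorUnitary = D := by
    intro D
    rw [Unitary.conjStarAlgAut_apply]
    change (hA.eigenvectorUnitary : Matrix n n ℂ)ᴴ * (_ * D *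
      (hA.eigenvectorUnitary : Matrix n n ℂ)ᴴ) * _ = D
    rw [Matrix.mul_assoc, Matrix.mul_assoc, h1, Matrix.mul_one, ← Matrix.mul_assoc, h1,
      Matrix.one_mul]
  refine ⟨hA.eigenvectorUnitary, hA.eigenvalues, h1, h2, ?_, fun f => ?_⟩
  · exact (congrArg (fun M => (hA.eigenvectorUnitary : Matrix n n ℂ)ᴴ * M *
      hA.eigenvectorUnitary) hA.spectral_theorem).trans (h3 _)
  · rw [hA.cfc_eq, IsHermitian.cfc]
    exact h3 _

theorem star_dotProduct_diagonal_mulVec [DecidableEq ι] (f : ι → ℝ) (v : ι → ℂ) :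
    star v ⬝ᵥ (diagonal (fun i => (f i : ℂ)) *ᵥ v) =
      ((∑ i, Complex.normSq (v i) * f i : ℝ) : ℂ) := by
  rw [dotProduct]
  push_cast
  refine Finset.sum_congr rfl fun k _ => ?_
  rw [mulVec_diagonal, Pi.star_apply, Complex.normSq_eq_conj_mul_self, RCLike.star_def]
  ring

theorem diagonal_ofReal_isHermitian {ι : Type*} [DecidableEq ι] (d : ι → ℝ) :
    (diagonal fun i => (d i : ℂ)).IsHermitian := by
  simp [IsHermitian, diagonal_conjTranspose, Pi.star_def]

/-- Operator concavity of the logarithm, in Jensen form: compressing a positive diagonal matrix by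
an isometry `V` before taking the logarithm gives at least the compression of the logarithm. -/
theorem posSemidef_cfc_log_compression_sub [DecidableEq ι] [DecidableEq n] {V : Matrix ι n ℂ}
    (hV : Vᴴ * V = 1) {d : ι → ℝ} (hd : ∀ i, 0 < d i) :
    (cfc Real.log (Vᴴ * diagonal (fun i => (d i : ℂ)) * V) -
      Vᴴ * diagonal (fun i => (Real.log (d i) : ℂ)) * V).PosSemidef := by
  have hA := isHermitian_conjTranspose_mul_mul V (diagonal_ofReal_isHermitian d)
  obtain ⟨U, δ, hU, hU', hδ, hcfc⟩ := exists_unitary_cfc_eq hA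
  have hX : (V * U)ᴴ * (V * U) = 1 := by
    rw [conjTranspose_mul, Matrix.mul_assoc, ← Matrix.mul_assoc Vᴴ, hV, Matrix.one_mul, hU]
  have hXδ : (V * U)ᴴ * diagonal (fun i => (d i : ℂ)) * (V * U) = diagonal fun k => (δ k : ℂ) := by
    rw [← hδ, conjTranspose_mul]; simp only [Matrix.mul_assoc]
  have hδ0 : ∀ k, 0 < δ k := by
    have hD : (diagonal (fun i => (d i : ℂ))).PosDef :=
      .diagonal fun i => by exact_mod_cast hd i
    have hinj : Function.Injective (V * U).mulVec := by
      intro x y hxy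
      have := congrArg ((V * U)ᴴ).mulVec hxy
      rwa [mulVec_mulVec, mulVec_mulVec, hX, one_mulVec, one_mulVec] at this
    have := hD.conjTranspose_mul_mul_same hinj
    rw [hXδ, posDef_diagonal_iff] at this
    exact fun k => by exact_mod_cast this k
  have hmain : (diagonal (fun k => (Real.log (δ k) : ℂ)) -
      (V * U)ᴴ * diagonal (fun i => (Real.log (d i) : ℂ)) * (V * U)).PosSemidef := by
    refine .of_dotProduct_mulVec_nonneg ((diagonal_ofReal_isHermitian _).sub
      (isHermitian_conjTranspose_mul_mul _ (diagonal_ofReal_isHermitian _))) fun u => ?_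
    have h2 : star u ⬝ᵥ (((V * U)ᴴ * diagonal (fun i => (Real.log (d i) : ℂ)) * (V * U)) *ᵥ u) =
        star ((V * U) *ᵥ u) ⬝ᵥ (diagonal (fun i => (Real.log (d i) : ℂ)) *ᵥ ((V * U) *ᵥ u)) := by
      rw [star_mulVec, Matrix.mul_assoc, ← mulVec_mulVec, ← mulVec_mulVec, dotProduct_mulVec]
    rw [sub_mulVec, dotProduct_sub, h2, star_dotProduct_diagonal_mulVec,
      star_dotProduct_diagonal_mulVec, ← Complex.ofReal_sub]
    exact_mod_cast sub_nonneg.2 (sum_normSq_mul_log_le_of_compression hX hXδ hd hδ0 u)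
  have h := hmain.mul_mul_conjTranspose_same U
  have hback : ∀ M : Matrix n n ℂ, U * (Uᴴ * M * U) * Uᴴ = M := by
    intro M
    rw [Matrix.mul_assoc, Matrix.mul_assoc, Matrix.mul_assoc, hU', Matrix.mul_one,
      ← Matrix.mul_assoc, hU', Matrix.one_mul]
  rw [← hcfc Real.log, conjTranspose_mul] at h
  rw [← hback (cfc Real.log _ - _)]
  convert h using 3
  simp only [Matrix.mul_sub, Matrix.sub_mul, Matrix.mul_assoc]

/-- If `V` is unitary, then compression by `V` commutes with the functional calculus. The index
types of `V` may differ. -/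
theorem cfc_compression_of_unitary [DecidableEq ι] [DecidableEq n] {V : Matrix ι n ℂ}
    (hV : Vᴴ * V = 1) (hV' : V * Vᴴ = 1) (d : ι → ℝ) (f : ℝ → ℝ) :
    cfc f (Vᴴ * diagonal (fun i => (d i : ℂ)) * V) =
      Vᴴ * diagonal (fun i => (f (d i) : ℂ)) * V := by
  have hA := isHermitian_conjTranspose_mul_mul V (diagonal_ofReal_isHermitian d)
  obtain ⟨U, δ, hU, hU', hδ, hcfc⟩ := exists_unitary_cfc_eq hA
  have hback : ∀ M : Matrix n n ℂ, U * (Uᴴ * M * U) * Uᴴ = M := by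
    intro M
    rw [Matrix.mul_assoc, Matrix.mul_assoc, Matrix.mul_assoc, hU', Matrix.mul_one,
      ← Matrix.mul_assoc, hU', Matrix.one_mul]
  have hcomm : diagonal (fun i => (d i : ℂ)) * (V * U) =
      (V * U) * diagonal (fun k => (δ k : ℂ)) := by
    rw [← hδ]
    calc diagonal (fun i => (d i : ℂ)) * (V * U)
        = (V * (U * Uᴴ) * Vᴴ) * (diagonal (fun i => (d i : ℂ)) * (V * U)) := by
          rw [hU', Matrix.mul_one, hV', Matrix.one_mul]
      _ = _ := by simp only [Matrix.mul_assoc]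
  -- Entrywise, `hcomm` says that `d i = δ k` wherever `(V * U) i k ≠ 0`.
  have hcomm' : diagonal (fun i => (f (d i) : ℂ)) * (V * U) =
      (V * U) * diagonal (fun k => (f (δ k) : ℂ)) := by
    ext i k
    have h1 := congrFun (congrFun hcomm i) k
    rw [diagonal_mul, mul_diagonal] at h1 ⊢
    by_cases h0 : (V * U) i k = 0
    · simp [h0]
    · rw [mul_comm] at h1
      have h2 : d i = δ k := by exact_mod_cast mul_left_cancel₀ h0 h1
      rw [h2, mul_comm]
  rw [← hback (cfc f _), hcfc f]
  calc U * diagonal (fun k => (f (δ k) : ℂ)) * Uᴴ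
      = Vᴴ * V * U * diagonal (fun k => (f (δ k) : ℂ)) * Uᴴ := by rw [hV, Matrix.one_mul]
    _ = Vᴴ * ((V * U) * diagonal (fun k => (f (δ k) : ℂ))) * Uᴴ := by simp only [Matrix.mul_assoc]
    _ = Vᴴ * diagonal (fun i => (f (d i) : ℂ)) * V * (U * Uᴴ) := by
        rw [← hcomm']; simp only [Matrix.mul_assoc]
    _ = _ := by rw [hU', Matrix.mul_one]

end LogCompression

/-! ### Operators in an orthonormal basis -/

section OperatorMatrix

open Matrix

variable {E : Type*} [NormedAddCommGroup E] [InnerProductSpace ℂ E]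
variable {ι : Type*} [Fintype ι] (e : OrthonormalBasis ι ℂ E)

/-- The matrix `⟨e m, a (e n)⟩` of an operator in an orthonormal basis. -/
noncomputable def opMatrix (a : Op E) : Matrix ι ι ℂ := Matrix.of fun m n => inner ℂ (e m) (a (e n))

theorem opMatrix_apply (a : Op E) (m n : ι) : opMatrix e a m n = inner ℂ (e m) (a (e n)) := rfl

theorem opMatrix_mul (a b : Op E) : opMatrix e (a * b) = opMatrix e a * opMatrix e b := by
  ext m n
  rw [Matrix.mul_apply, opMatrix_apply]
  change inner ℂ (e m) (a (b (e n))) = _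
  conv_lhs => rw [← e.sum_repr' (b (e n)), map_sum, inner_sum]
  refine Finset.sum_congr rfl fun k _ => ?_
  rw [map_smul, inner_smul_right, mul_comm]
  rfl

theorem opMatrix_sub (a b : Op E) : opMatrix e (a - b) = opMatrix e a - opMatrix e b := by
  ext m n
  simp [opMatrix_apply]

theorem opMatrix_star [CompleteSpace E] (a : Op E) : opMatrix e (star a) = (opMatrix e a)ᴴ := by
  ext m n
  rw [conjTranspose_apply, opMatrix_apply, opMatrix_apply, ContinuousLinearMap.star_eq_adjoint,
    ContinuousLinearMap.adjoint_inner_right, RCLike.star_def, inner_conj_symm]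

theorem opMatrix_injective : Function.Injective (opMatrix e) := by
  intro a b hab
  have h : ∀ n, a (e n) = b (e n) := fun n =>
    InnerProductSpace.ext_inner_left_basis e.toBasis fun m => by
      simpa [opMatrix_apply] using congrFun (congrFun hab m) n
  ext x
  exact congrFun (congrArg DFunLike.coe (e.toBasis.ext (f₁ := (a : E →ₗ[ℂ] E)) (f₂ := b)
    (by simpa using h))) x

theorem opTrace_eq_trace [DecidableEq ι] (a : Op E) : opTrace a = (opMatrix e a).trace :=
  LinearMap.trace_eq_sum_inner _ e

theorem exp_apply_of_apply_eq_smul [CompleteSpace E] {x : Op E} {v : E} {c : ℂ} (hv : x v = c • v) :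
    NormedSpace.exp x v = Complex.exp c • v := by
  have hpow : ∀ n : ℕ, (x ^ n) v = c ^ n • v := by
    intro n
    induction n with
    | zero => simp
    | succ n ih =>
      rw [pow_succ']
      change x ((x ^ n) v) = _
      rw [ih, map_smul, hv, smul_smul, pow_succ]
  have h1 := (NormedSpace.exp_series_hasSum_exp' (𝕂 := ℂ) x).mapL
    (ContinuousLinearMap.apply ℂ E v)
  have h2 := ((NormedSpace.exp_series_hasSum_exp' (𝕂 := ℂ) c)).smul_const v
  rw [← Complex.exp_eq_exp_ℂ] at h2
  refine h1.unique ?_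
  convert h2 using 2 with n
  simp [hpow, smul_smul]

/-- In an eigenbasis of `h` the Gibbs density is diagonal, with the Boltzmann weights as entries. -/
theorem gibbsState_apply [CompleteSpace E] [DecidableEq ι]
    {ω : Op E →ₗ[ℂ] ℂ} {h : Op E} {T : ℝ} (hω : IsGibbsState ω h T) {lam : ι → ℝ}
    (hlam : ∀ n, h (e n) = (lam n : ℂ) • e n) (a : Op E) :
    ω a = ∑ n, ((Real.exp (-(lam n / T)) / ∑ m, Real.exp (-(lam m / T)) : ℝ) : ℂ) *
      opMatrix e a n n := by
  have hexp : ∀ n, NormedSpace.exp (-(T⁻¹ • h)) (e n) = (Real.exp (-(lam n / T)) : ℂ) • e n := by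
    intro n
    rw [exp_apply_of_apply_eq_smul (c := ((-(lam n / T) : ℝ) : ℂ)), Complex.ofReal_exp]
    rw [_root_.neg_apply, _root_.smul_apply, hlam, ← Complex.coe_smul,
      smul_smul, ← neg_smul]
    congr 1
    push_cast
    ring
  have hZ : opTrace (NormedSpace.exp (-(T⁻¹ • h))) =
      ((∑ m, Real.exp (-(lam m / T)) : ℝ) : ℂ) := by
    rw [opTrace_eq_trace e, Matrix.trace]
    push_cast
    refine Finset.sum_congr rfl fun n _ => ?_
    rw [Matrix.diag_apply, opMatrix_apply, hexp, inner_smul_right]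
    simp
  have hρ : opMatrix e (gibbsDensity h T) = Matrix.diagonal fun n =>
      ((Real.exp (-(lam n / T)) / ∑ m, Real.exp (-(lam m / T)) : ℝ) : ℂ) := by
    ext m n
    rw [opMatrix_apply, gibbsDensity, _root_.smul_apply, hexp, hZ, smul_smul,
      inner_smul_right, orthonormal_iff_ite.1 e.orthonormal, Matrix.diagonal_apply]
    split_ifs with hmn
    · subst hmn
      push_cast
      ring
    · simp
  rw [hω.2 a, opTrace_eq_trace e, opMatrix_mul, hρ, Matrix.trace]
  refine Finset.sum_congr rfl fun n _ => ?_
  rw [Matrix.diag_apply, Matrix.diagonal_mul]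

end OperatorMatrix

/-! ### Coordinates for the GNS inner product -/

section Coordinates

open Matrix

variable {E : Type*} [NormedAddCommGroup E] [InnerProductSpace ℂ E]
variable {ι : Type*} [Fintype ι] (e : OrthonormalBasis ι ℂ E) (p : ι → ℝ) {r : ℕ}

/-- The GNS coordinates of `a₁, …, a_r`, as columns: the component of `a j` at `(m, n)` is
`√(p n) * ⟨e m, a j (e n)⟩`. If `ω` has the density with eigenvectors `e` and eigenvalues `p`, these
are coordinates in an orthonormal basis of the algebra for the inner product `ω (x* y)`. -/
noncomputable def gnsMatrix (a : Fin r → Op E) : Matrix (ι × ι) (Fin r) ℂ :=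
  Matrix.of fun x j => (√(p x.2) : ℂ) * opMatrix e (a j) x.1 x.2

/-- The matrix of `x ↦ [k, x]` in the GNS coordinates of `gnsMatrix`. -/
noncomputable def adMatrix [DecidableEq ι] (k : Op E) : Matrix (ι × ι) (ι × ι) ℂ :=
  Matrix.of fun x x' => (if x.2 = x'.2 then opMatrix e k x.1 x'.1 else 0) -
    if x.1 = x'.1 then (√(p x.2) / √(p x'.2) : ℂ) * opMatrix e k x'.2 x.2 else 0

variable {e p} {ω : Op E →ₗ[ℂ] ℂ} {a : Fin r → Op E}

theorem gnsMatrix_conjTranspose_mul_self [CompleteSpace E] [DecidableEq ι] (hp : ∀ n, 0 < p n)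
    (hω : ∀ x, ω x = ∑ n, (p n : ℂ) * opMatrix e x n n)
    (ha : ∀ i j, ω (star (a i) * a j) = if i = j then 1 else 0) :
    (gnsMatrix e p a)ᴴ * gnsMatrix e p a = 1 := by
  ext i j
  rw [Matrix.one_apply, ← ha, hω, Matrix.mul_apply, Fintype.sum_prod_type_right]
  refine Finset.sum_congr rfl fun n _ => ?_
  rw [opMatrix_mul, opMatrix_star, Matrix.mul_apply, Finset.mul_sum]
  refine Finset.sum_congr rfl fun m _ => ?_
  have hs : (√(p n) : ℂ) * √(p n) = p n := by
    rw [← Complex.ofReal_mul, Real.mul_self_sqrt (hp n).le]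
  simp only [conjTranspose_apply, gnsMatrix, Matrix.of_apply, star_mul', RCLike.star_def,
    Complex.conj_ofReal, ← hs]
  ring

/-- `Δ` is the compression of the modular operator `x ↦ ρ x ρ⁻¹`, with eigenvalues `p m / p n`. -/
theorem deltaMatrix_eq_compression [CompleteSpace E] [DecidableEq ι] (hp : ∀ n, 0 < p n)
    (hω : ∀ x, ω x = ∑ n, (p n : ℂ) * opMatrix e x n n) :
    deltaMatrix ω a = (gnsMatrix e p a)ᴴ *
      diagonal (fun x : ι × ι => ((p x.1 / p x.2 : ℝ) : ℂ)) * gnsMatrix e p a := by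
  ext i j
  rw [Matrix.mul_apply, Fintype.sum_prod_type]
  simp only [deltaMatrix, Matrix.of_apply, hω, mul_diagonal]
  refine Finset.sum_congr rfl fun m _ => ?_
  rw [opMatrix_mul, opMatrix_star, Matrix.mul_apply, Finset.mul_sum]
  refine Finset.sum_congr rfl fun n _ => ?_
  have hs : (√(p n) : ℂ) * √(p n) = p n := by
    rw [← Complex.ofReal_mul, Real.mul_self_sqrt (hp n).le]
  have hs0 : (√(p n) : ℂ) ≠ 0 := by exact_mod_cast (Real.sqrt_pos.2 (hp n)).ne'
  simp only [conjTranspose_apply, gnsMatrix, Matrix.of_apply, star_mul', RCLike.star_def,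
    Complex.conj_ofReal]
  push_cast
  rw [← hs]
  field_simp

theorem adMatrix_mul_gnsMatrix [DecidableEq ι] (hp : ∀ n, 0 < p n) (k : Op E) :
    adMatrix e p k * gnsMatrix e p a = gnsMatrix e p fun j => comm k (a j) := by
  ext x j
  rw [Matrix.mul_apply, Fintype.sum_prod_type]
  simp only [adMatrix, gnsMatrix, Matrix.of_apply, comm, opMatrix_sub, opMatrix_mul,
    Matrix.sub_apply, Matrix.mul_apply, sub_mul, Finset.sum_sub_distrib, mul_sub, ite_mul, zero_mul]
  congr 1
  · rw [Finset.mul_sum]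
    refine Finset.sum_congr rfl fun m _ => ?_
    rw [Finset.sum_ite_eq]
    simp only [Finset.mem_univ, if_true]
    ring
  · rw [Finset.sum_comm, Finset.mul_sum]
    refine Finset.sum_congr rfl fun n _ => ?_
    rw [Finset.sum_ite_eq]
    have hs0 : (√(p n) : ℂ) ≠ 0 := by exact_mod_cast (Real.sqrt_pos.2 (hp n)).ne'
    simp only [Finset.mem_univ, if_true]
    field_simp

theorem commMatrix_eq_compression [CompleteSpace E] [DecidableEq ι] (hp : ∀ n, 0 < p n)
    (hω : ∀ x, ω x = ∑ n, (p n : ℂ) * opMatrix e x n n) (k : Op E) :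
    commMatrix ω a k = (gnsMatrix e p a)ᴴ * adMatrix e p k * gnsMatrix e p a := by
  rw [Matrix.mul_assoc, adMatrix_mul_gnsMatrix hp]
  ext i j
  rw [Matrix.mul_apply, Fintype.sum_prod_type_right]
  simp only [commMatrix, Matrix.of_apply, hω]
  refine Finset.sum_congr rfl fun n _ => ?_
  rw [opMatrix_mul, opMatrix_star, Matrix.mul_apply, Finset.mul_sum]
  refine Finset.sum_congr rfl fun m _ => ?_
  have hs : (√(p n) : ℂ) * √(p n) = p n := by
    rw [← Complex.ofReal_mul, Real.mul_self_sqrt (hp n).le]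
  simp only [conjTranspose_apply, gnsMatrix, Matrix.of_apply, star_mul', RCLike.star_def,
    Complex.conj_ofReal, ← hs]
  ring

theorem adMatrix_eq_diagonal [DecidableEq ι] (hp : ∀ n, 0 < p n) {h : Op E} {lam : ι → ℝ}
    (hlam : ∀ n, h (e n) = (lam n : ℂ) • e n) :
    adMatrix e p h = diagonal fun x : ι × ι => ((lam x.1 - lam x.2 : ℝ) : ℂ) := by
  have hK : opMatrix e h = diagonal fun n => (lam n : ℂ) := by
    ext m n
    rw [opMatrix_apply, hlam, inner_smul_right, orthonormal_iff_ite.1 e.orthonormal,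
      diagonal_apply]
    split_ifs with hmn <;> simp [hmn]
  ext ⟨m, n⟩ ⟨m', n'⟩
  have hs0 : (√(p n) : ℂ) ≠ 0 := by exact_mod_cast (Real.sqrt_pos.2 (hp n)).ne'
  simp only [adMatrix, hK, Matrix.of_apply, diagonal_apply, Prod.mk.injEq]
  by_cases h1 : m = m' <;> by_cases h2 : n = n' <;> simp [h1, h2, Ne.symm]
  · subst h2; field_simp

theorem adMatrix_apply_self [DecidableEq ι] (hp : ∀ n, 0 < p n) (k : Op E) (x : ι × ι) :
    adMatrix e p k x x = opMatrix e k x.1 x.1 - opMatrix e k x.2 x.2 := by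
  have hs0 : (√(p x.2) : ℂ) ≠ 0 := by exact_mod_cast (Real.sqrt_pos.2 (hp x.2)).ne'
  simp [adMatrix, hs0]

theorem trace_adMatrix [DecidableEq ι] (hp : ∀ n, 0 < p n) (k : Op E) :
    (adMatrix e p k).trace = 0 := by
  rw [Matrix.trace, Fintype.sum_prod_type]
  simp only [Matrix.diag_apply, adMatrix_apply_self hp, Finset.sum_sub_distrib]
  rw [Finset.sum_comm, sub_self]

/-- A traceless operator in the kernel of `ad` is zero: such an operator is a scalar, and its trace
determines the scalar. -/
theorem eq_zero_of_adMatrix_eq_zero [DecidableEq ι] (hp : ∀ n, 0 < p n) {k : Op E}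
    (htr : opTrace k = 0) (had : adMatrix e p k = 0) : k = 0 := by
  apply opMatrix_injective e
  have h0 : opMatrix e (0 : Op E) = 0 := by ext; simp [opMatrix_apply]
  rw [h0]
  have hdiag : ∀ m n, opMatrix e k m m = opMatrix e k n n := fun m n => by
    rw [← sub_eq_zero, ← adMatrix_apply_self hp k (m, n), had]; rfl
  ext m n
  by_cases hmn : m = n
  · subst hmn
    rw [opTrace_eq_trace e, Matrix.trace] at htr
    simp only [Matrix.diag_apply, hdiag _ m, Finset.sum_const, Finset.card_univ, nsmul_eq_mul,
      mul_eq_zero, Nat.cast_eq_zero, Fintype.card_eq_zero_iff] at htr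
    exact htr.resolve_left fun h => h.elim m
  · have := congrFun (congrFun had (m, n)) (n, n)
    simpa [adMatrix, hmn] using this

end Coordinates

/-! ### Linearity, the kernel of `W` and rescaling -/

section Program

open Matrix

variable {E : Type*} [NormedAddCommGroup E] [InnerProductSpace ℂ E]
variable {r s q : ℕ}

/-- `commMatrix ω a` as a real-linear map. -/
noncomputable def commMatrixLinear [CompleteSpace E] (ω : Op E →ₗ[ℂ] ℂ) (a : Fin r → Op E) :
    Op E →ₗ[ℝ] Matrix (Fin r) (Fin r) ℂ where
  toFun := commMatrix ω a
  map_add' x y := by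
    ext i j
    simp only [commMatrix, comm, Matrix.of_apply, Matrix.add_apply, ← map_add, ← mul_add]
    congr 2
    noncomm_ring
  map_smul' c x := by
    ext i j
    simp only [commMatrix, comm, Matrix.of_apply, Matrix.smul_apply, RingHom.id_apply]
    rw [← Complex.coe_smul c x, ← Complex.coe_smul c (ω _), ← map_smul, smul_mul_assoc,
      mul_smul_comm, ← smul_sub, mul_smul_comm]

theorem commMatrix_sum_smul [CompleteSpace E] (ω : Op E →ₗ[ℂ] ℂ) (a : Fin r → Op E) {m : ℕ}
    (y : Fin m → ℝ) (x : Fin m → Op E) :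
    commMatrix ω a (∑ β, y β • x β) = ∑ β, y β • commMatrix ω a (x β) := by
  change commMatrixLinear ω a _ = ∑ β, y β • commMatrixLinear ω a (x β)
  simp only [map_sum, map_smul]

theorem map_sum_real_smul (ω : Op E →ₗ[ℂ] ℂ) {m : ℕ} (y : Fin m → ℝ) (x : Fin m → Op E) :
    ω (∑ β, y β • x β) = ∑ β, (y β : ℂ) * ω (x β) := by
  rw [map_sum]
  refine Finset.sum_congr rfl fun β _ => ?_
  rw [← Complex.coe_smul, map_smul, smul_eq_mul]

/-- `W` is the Gram matrix of the anti-Hermitian matrices `H_α - H_α†`, so it kills `y` as soon as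
`∑ α, y α H_α` is Hermitian. -/
theorem wMatrix_mulVec_eq_zero [CompleteSpace E] {ω : Op E →ₗ[ℂ] ℂ} {a : Fin r → Op E}
    {hs : Fin s → Op E} {y : Fin s → ℝ} (hy : (commMatrix ω a (∑ α, y α • hs α)).IsHermitian) :
    (wMatrix ω a hs).mulVec (fun α => (y α : ℂ)) = 0 := by
  have hzero : ∑ β, (y β : ℂ) • (commMatrix ω a (hs β) - (commMatrix ω a (hs β))ᴴ) = 0 := by
    have h1 := hy.eq
    rw [commMatrix_sum_smul] at h1
    simp only [smul_sub, Finset.sum_sub_distrib, sub_eq_zero, Complex.coe_smul]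
    rw [← h1, conjTranspose_sum]
    refine Finset.sum_congr rfl fun β _ => ?_
    rw [conjTranspose_smul, star_trivial]
  ext α
  simp only [mulVec, dotProduct, wMatrix, Matrix.of_apply, Pi.zero_apply]
  calc _ = (((commMatrix ω a (hs α))ᴴ - commMatrix ω a (hs α)) *
        ∑ β, (y β : ℂ) • (commMatrix ω a (hs β) - (commMatrix ω a (hs β))ᴴ)).trace := by
        rw [Finset.mul_sum, trace_sum]
        refine Finset.sum_congr rfl fun β _ => ?_
        rw [mul_smul_comm, trace_smul, smul_eq_mul, mul_comm]
    _ = 0 := by rw [hzero, mul_zero, trace_zero]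

theorem sum_repr_smul_kernelOperators [CompleteSpace E] (ω : Op E →ₗ[ℂ] ℂ) (a : Fin r → Op E)
    (hs : Fin s → Op E) (k : Module.Basis (Fin q) ℝ (wKernel ω a hs)) (x : wKernel ω a hs) :
    ∑ β, k.repr x β • kernelOperators ω a hs k β = ∑ α, (x : Fin s → ℝ) α • hs α := by
  have hx : ∀ α, (x : Fin s → ℝ) α = ∑ β, k.repr x β * (k β : Fin s → ℝ) α := by
    intro α
    conv_lhs => rw [← k.sum_repr x]
    simp [-Module.Basis.sum_repr]
  simp only [kernelOperators, Finset.smul_sum, smul_smul]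
  rw [Finset.sum_comm]
  refine Finset.sum_congr rfl fun α _ => ?_
  rw [hx, Finset.sum_smul]

theorem IsGibbsState.smul {ω : Op E →ₗ[ℂ] ℂ} {h : Op E} {T c : ℝ} (hω : IsGibbsState ω h T)
    (hc : 0 < c) : IsGibbsState ω (c • h) (c * T) := by
  refine ⟨mul_pos hc hω.1, fun a => ?_⟩
  have : (c * T)⁻¹ • c • h = T⁻¹ • h := by
    rw [smul_smul]
    congr 1
    field_simp
  rw [hω.2 a, gibbsDensity, gibbsDensity, this]

theorem opTrace_sum_smul {m : ℕ} {x : Fin m → Op E} (hx : ∀ β, opTrace (x β) = 0)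
    (y : Fin m → ℝ) : opTrace (∑ β, y β • x β) = 0 := by
  have : ∀ z : Op E, opTrace z =
      (LinearMap.trace ℂ E ∘ₗ ContinuousLinearMap.coeLM ℂ) z := fun z => rfl
  rw [this, map_sum_real_smul]
  exact Finset.sum_eq_zero fun β _ => by rw [← this, hx, mul_zero]

end Program

/-! ### Gibbs states and the semidefinite constraint -/

section Gibbs

open Matrix

/-- Each term satisfies `x * exp (-x / T) ≤ x`, with equality only for `x = 0`. -/
theorem sum_mul_exp_neg_div_neg {ι : Type*} [Fintype ι] {lam : ι → ℝ} (hsum : ∑ n, lam n = 0)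
    (hne : ∃ n, lam n ≠ 0) {T : ℝ} (hT : 0 < T) : ∑ n, lam n * Real.exp (-(lam n / T)) < 0 := by
  have hle : ∀ n, lam n * Real.exp (-(lam n / T)) ≤ lam n ∧
      (lam n ≠ 0 → lam n * Real.exp (-(lam n / T)) < lam n) := by
    intro n
    rcases lt_trichotomy (lam n) 0 with h | h | h
    · have : 1 < Real.exp (-(lam n / T)) :=
        Real.one_lt_exp_iff.2 (neg_pos.2 (div_neg_of_neg_of_pos h hT))
      have := mul_lt_mul_of_neg_left this h
      rw [mul_one] at this
      exact ⟨this.le, fun _ => this⟩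
    · simp [h]
    · have : Real.exp (-(lam n / T)) < 1 :=
        Real.exp_lt_one_iff.2 (neg_lt_zero.2 (div_pos h hT))
      have := mul_lt_mul_of_pos_left this h
      rw [mul_one] at this
      exact ⟨this.le, fun _ => this⟩
  obtain ⟨n, hn⟩ := hne
  rw [← hsum]
  exact Finset.sum_lt_sum (fun n _ => (hle n).1) ⟨n, Finset.mem_univ n, (hle n).2 hn⟩

variable {E : Type*} [NormedAddCommGroup E] [InnerProductSpace ℂ E] [CompleteSpace E]

/-- Spectral data of a Gibbs state: an eigenbasis `e` of `h`, its eigenvalues `lam`, and the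
Boltzmann weights `p`, with their partition function `Z`. They satisfy
`T log (p m / p n) = -(lam m - lam n)`. -/
theorem exists_eigenbasis_gibbs [FiniteDimensional ℂ E] {ω : Op E →ₗ[ℂ] ℂ} {h : Op E} {T : ℝ}
    (h_sa : IsSelfAdjoint h) (hω : IsGibbsState ω h T) :
    ∃ (e : OrthonormalBasis (Fin (Module.finrank ℂ E)) ℂ E)
      (lam p : Fin (Module.finrank ℂ E) → ℝ),
      (∀ n, h (e n) = (lam n : ℂ) • e n) ∧ (∀ n, 0 < p n) ∧
      (∀ x, ω x = ∑ n, (p n : ℂ) * opMatrix e x n n) ∧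
      (∀ m n, T * Real.log (p m / p n) = -(lam m - lam n)) ∧
      ∃ Z : ℝ, 0 ≤ Z ∧ ∀ n, p n = Real.exp (-(lam n / T)) / Z := by
  have hsym : (h : E →ₗ[ℂ] E).IsSymmetric := h_sa.isSymmetric
  set e := hsym.eigenvectorBasis rfl
  set lam := hsym.eigenvalues rfl
  have hlam : ∀ n, h (e n) = (lam n : ℂ) • e n := fun n => hsym.apply_eigenvectorBasis rfl n
  have hZ : ∀ n : Fin (Module.finrank ℂ E), 0 < ∑ m, Real.exp (-(lam m / T)) := fun n =>
    Finset.sum_pos (fun m _ => Real.exp_pos _) ⟨n, Finset.mem_univ n⟩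
  refine ⟨e, lam, fun n => Real.exp (-(lam n / T)) / ∑ m, Real.exp (-(lam m / T)), hlam,
    fun n => div_pos (Real.exp_pos _) (hZ n), gibbsState_apply e hω hlam, fun m n => ?_,
    ∑ m, Real.exp (-(lam m / T)), Finset.sum_nonneg fun m _ => (Real.exp_pos _).le, fun n => rfl⟩
  rw [div_div_div_cancel_right₀ (hZ n).ne', ← Real.exp_sub, Real.log_exp]
  field_simp [hω.1.ne']
  ring

theorem exists_gibbs_expectation_eq_neg [FiniteDimensional ℂ E] {ω : Op E →ₗ[ℂ] ℂ} {h : Op E}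
    {T : ℝ} (h_sa : IsSelfAdjoint h) (h_tr : opTrace h = 0) (h_ne : h ≠ 0)
    (hω : IsGibbsState ω h T) : ∃ c : ℝ, 0 < c ∧ ω h = -(c : ℂ) := by
  obtain ⟨e, lam, p, hlam, hp, hωp, -, Z, hZ0, hZ⟩ := exists_eigenbasis_gibbs h_sa hω
  have hentry : ∀ n, opMatrix e h n n = (lam n : ℂ) := fun n => by
    rw [opMatrix_apply, hlam, inner_smul_right]; simp
  have hsum : ∑ n, lam n = 0 := by
    rw [opTrace_eq_trace e, Matrix.trace] at h_tr
    simp only [Matrix.diag_apply, hentry] at h_tr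
    exact_mod_cast h_tr
  have hne : ∃ n, lam n ≠ 0 := by
    by_contra! h0
    apply h_ne
    ext x
    exact congrFun (congrArg DFunLike.coe (e.toBasis.ext (f₁ := (h : E →ₗ[ℂ] E)) (f₂ := 0)
      fun n => by simp [hlam, h0])) x
  have hneg := sum_mul_exp_neg_div_neg hsum hne hω.1
  obtain ⟨n₀, -⟩ := hne
  have hZpos : 0 < Z := by
    refine hZ0.lt_of_ne fun h => ?_
    have := hp n₀
    rw [hZ, ← h, div_zero] at this
    exact this.false
  refine ⟨-((∑ n, lam n * Real.exp (-(lam n / T))) / Z),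
    neg_pos.2 (div_neg_of_neg_of_pos hneg hZpos), ?_⟩
  rw [hωp]
  simp only [hentry, hZ]
  push_cast
  rw [neg_neg, Finset.sum_div]
  exact Finset.sum_congr rfl fun n _ => by ring

variable {r : ℕ} [FiniteDimensional ℂ E] {ω : Op E →ₗ[ℂ] ℂ} {h : Op E} {T : ℝ}
  {a : Fin r → Op E}

theorem gibbs_commMatrix_isHermitian (h_sa : IsSelfAdjoint h) (hω : IsGibbsState ω h T) :
    (commMatrix ω a h).IsHermitian := by
  obtain ⟨e, lam, p, hlam, hp, hωp, -⟩ := exists_eigenbasis_gibbs h_sa hω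
  rw [commMatrix_eq_compression hp hωp, adMatrix_eq_diagonal hp hlam]
  exact isHermitian_conjTranspose_mul_mul _ (diagonal_ofReal_isHermitian _)

theorem smul_diagonal_log_eq {ι : Type*} [DecidableEq ι] {lam p : ι → ℝ}
    (hlog : ∀ m n, T * Real.log (p m / p n) = -(lam m - lam n)) :
    diagonal (fun x : ι × ι => ((lam x.1 - lam x.2 : ℝ) : ℂ)) =
      -(T • diagonal fun x : ι × ι => (Real.log (p x.1 / p x.2) : ℂ)) := by
  ext x x'
  simp only [Matrix.neg_apply, Matrix.smul_apply, diagonal_apply]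
  split_ifs
  · rw [Complex.real_smul, ← Complex.ofReal_mul, hlog, Complex.ofReal_neg, neg_neg]
  · simp

/-- The Gibbs Hamiltonian and its temperature satisfy the matrix constraint with `μ = 0`. -/
theorem gibbs_posSemidef (h_sa : IsSelfAdjoint h) (hω : IsGibbsState ω h T)
    (ha : ∀ i j, ω (star (a i) * a j) = if i = j then 1 else 0) :
    (T • cfc Real.log (deltaMatrix ω a) + commMatrix ω a h).PosSemidef := by
  obtain ⟨e, lam, p, hlam, hp, hωp, hlog, -⟩ := exists_eigenbasis_gibbs h_sa hω
  have hJ := posSemidef_cfc_log_compression_sub (gnsMatrix_conjTranspose_mul_self hp hωp ha)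
    (d := fun x => p x.1 / p x.2) fun x => div_pos (hp _) (hp _)
  rw [commMatrix_eq_compression hp hωp, adMatrix_eq_diagonal hp hlam, smul_diagonal_log_eq hlog,
    deltaMatrix_eq_compression hp hωp]
  convert hJ.smul hω.1.le using 1
  rw [smul_sub, Matrix.mul_neg, Matrix.neg_mul, Matrix.mul_smul, Matrix.smul_mul, sub_eq_add_neg]

/-- If the `a i` span the algebra, the matrix constraint at the Gibbs Hamiltonian is an equality.
Since the `a i` are orthonormal, spanning amounts to `r = (dim E)²`. -/
theorem gibbs_smul_cfc_log_eq (h_sa : IsSelfAdjoint h) (hω : IsGibbsState ω h T)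
    (ha : ∀ i j, ω (star (a i) * a j) = if i = j then 1 else 0)
    (hr : r = Module.finrank ℂ E * Module.finrank ℂ E) :
    T • cfc Real.log (deltaMatrix ω a) = -commMatrix ω a h := by
  obtain ⟨e, lam, p, hlam, hp, hωp, hlog, -⟩ := exists_eigenbasis_gibbs h_sa hω
  have hV := gnsMatrix_conjTranspose_mul_self hp hωp ha
  have hV' := (mul_eq_one_comm_of_card_eq _ _ _ (by simp [hr])).1 hV
  rw [commMatrix_eq_compression hp hωp, adMatrix_eq_diagonal hp hlam, smul_diagonal_log_eq hlog,
    deltaMatrix_eq_compression hp hωp, cfc_compression_of_unitary hV hV']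
  rw [Matrix.mul_neg, Matrix.neg_mul, Matrix.mul_smul, Matrix.smul_mul, neg_neg]

/-- If the `a i` span the algebra, `H(k)` has the trace of `ad k`, which is zero. A lower bound `μ`
of `H(k)` is therefore at most `0`, and `μ = 0` leaves only `k = 0` among the traceless operators. -/
theorem nonpos_and_eq_zero_of_posSemidef [Nontrivial E]
    (h_sa : IsSelfAdjoint h) (hω : IsGibbsState ω h T)
    (ha : ∀ i j, ω (star (a i) * a j) = if i = j then 1 else 0)
    (hr : r = Module.finrank ℂ E * Module.finrank ℂ E) {k : Op E} (hk : opTrace k = 0) {μ : ℝ}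
    (hpos : (commMatrix ω a k - μ • (1 : Matrix (Fin r) (Fin r) ℂ)).PosSemidef) :
    μ ≤ 0 ∧ (μ = 0 → k = 0) := by
  obtain ⟨e, lam, p, hlam, hp, hωp, -⟩ := exists_eigenbasis_gibbs h_sa hω
  have hV := gnsMatrix_conjTranspose_mul_self hp hωp ha
  have hV' := (mul_eq_one_comm_of_card_eq _ _ _ (by simp [hr])).1 hV
  have htr : (commMatrix ω a k).trace = 0 := by
    rw [commMatrix_eq_compression hp hωp, Matrix.mul_assoc, trace_mul_comm, Matrix.mul_assoc, hV',
      Matrix.mul_one, trace_adMatrix hp]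
  refine ⟨?_, fun hμ => ?_⟩
  · have h1 := hpos.trace_nonneg
    rw [trace_sub, htr, trace_smul, trace_one, Fintype.card_fin, zero_sub, Complex.real_smul,
      ← Complex.ofReal_natCast, ← Complex.ofReal_mul, ← Complex.ofReal_neg,
      Complex.zero_le_real] at h1
    have hr0 : (0 : ℝ) < r := by
      have := Module.finrank_pos (R := ℂ) (M := E)
      rw [hr]
      exact_mod_cast Nat.mul_pos this this
    by_contra! hcon
    have := mul_pos hcon hr0
    linarith
  · rw [hμ, zero_smul, sub_zero] at hpos
    have h0 := hpos.trace_eq_zero_iff.1 htr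
    refine eq_zero_of_adMatrix_eq_zero (e := e) hp hk ?_
    rw [commMatrix_eq_compression hp hωp] at h0
    calc adMatrix e p k = gnsMatrix e p a * ((gnsMatrix e p a)ᴴ * adMatrix e p k *
          gnsMatrix e p a) * (gnsMatrix e p a)ᴴ := by
          rw [Matrix.mul_assoc, Matrix.mul_assoc, Matrix.mul_assoc, hV', Matrix.mul_one,
            ← Matrix.mul_assoc, hV', Matrix.one_mul]
      _ = 0 := by rw [h0, Matrix.mul_zero, Matrix.zero_mul]

/-- If the `a i` span the algebra, the objective is at most `0` on feasible points, and the value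
`0` is attained only at the normalized Gibbs Hamiltonian and its temperature. -/
theorem nonpos_and_eq_of_isFeasible [Nontrivial E] {q : ℕ} {ht : Fin q → Op E}
    (h_sa : IsSelfAdjoint h) (h_tr : opTrace h = 0) (hω : IsGibbsState ω h T) (hω1 : ω h = -1)
    (ha : ∀ i j, ω (star (a i) * a j) = if i = j then 1 else 0)
    (hr : r = Module.finrank ℂ E * Module.finrank ℂ E) (ht_tr : ∀ β, opTrace (ht β) = 0)
    {y : Fin q → ℝ} {T' μ : ℝ} (hf : IsFeasible ω a ht y T' μ) :
    μ ≤ 0 ∧ (μ = 0 → ∑ β, y β • ht β = h ∧ T' = T) := by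
  obtain ⟨-, hpos, hnorm⟩ := hf
  rw [← commMatrix_sum_smul] at hpos
  rw [← map_sum_real_smul] at hnorm
  have htr' : opTrace (∑ β, y β • ht β) = 0 := opTrace_sum_smul ht_tr y
  generalize ∑ β, y β • ht β = h' at *
  obtain ⟨t, rfl⟩ : ∃ t, T' = t * T := ⟨T' / T, (div_mul_cancel₀ _ hω.1.ne').symm⟩
  have hlog : (t * T) • cfc Real.log (deltaMatrix ω a) + commMatrix ω a h' =
      commMatrix ω a (h' - t • h) := by
    rw [mul_smul, gibbs_smul_cfc_log_eq h_sa hω ha hr]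
    change _ = commMatrixLinear ω a _
    rw [map_sub, map_smul, smul_neg, neg_add_eq_sub]
    rfl
  have hk_tr : opTrace (h' - t • h) = 0 := by
    have := opTrace_sum_smul (x := ![h', h]) (by simp [Fin.forall_fin_two, htr', h_tr]) ![1, -t]
    simpa [Fin.sum_univ_two, sub_eq_add_neg] using this
  rw [hlog] at hpos
  obtain ⟨hμ, hk⟩ := nonpos_and_eq_zero_of_posSemidef h_sa hω ha hr hk_tr hpos
  refine ⟨hμ, fun h0 => ?_⟩
  have heq : h' = t • h := sub_eq_zero.1 (hk h0)
  have ht1 : t = 1 := by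
    rw [heq, ← Complex.coe_smul, map_smul, hω1, smul_eq_mul, mul_neg, mul_one] at hnorm
    exact_mod_cast neg_injective hnorm
  exact ⟨by rw [heq, ht1, one_smul], by rw [ht1, one_mul]⟩

end Gibbs

end HamiltonianLearning

/-! ### The algorithm -/

theorem corollary1
    {E : Type*} [NormedAddCommGroup E] [InnerProductSpace ℂ E] [CompleteSpace E]
    [FiniteDimensional ℂ E]
    {s r q : ℕ}
    -- variational Hamiltonian terms: selfadjoint and traceless
    (hs : Fin s → Op E) (hs_sa : ∀ α, IsSelfAdjoint (hs α)) (hs_tr : ∀ α, opTrace (hs α) = 0)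
    -- perturbing operators: linearly independent, with a span closed under adjoints
    (b : Fin r → Op E) (hb : LinearIndependent ℂ b)
    (hb_star : Submodule.span ℂ (Set.range b) =
      Submodule.span ℂ (Set.range fun i => star (b i)))
    -- the Gibbs state of a nonzero Hamiltonian in the span of the variational terms
    (ω : Op E →ₗ[ℂ] ℂ) (y : Fin s → ℝ) (h : Op E) (hh : h = ∑ α, y α • hs α) (h_ne : h ≠ 0)
    (T : ℝ) (hω : IsGibbsState ω h T)
    -- the choices made in the first two steps of the algorithm
    (a : Fin r → Op E) (ha : IsOrthonormalization ω b a)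
    (k : Module.Basis (Fin q) ℝ (wKernel ω a hs)) :
    -- the algorithm does reach the semidefinite program
    ¬ IsUnit (wMatrix ω a hs) ∧
    -- the scale of `(h, T)` can be fixed so that `h` has expectation value `-1`
    ∃ c : ℝ, 0 < c ∧ ω h = -(c : ℂ) ∧ IsGibbsState ω (c⁻¹ • h) (c⁻¹ * T) ∧
      -- feasibility
      (IsFeasibleTriple ω a (kernelOperators ω a hs k) (c⁻¹ • h) (c⁻¹ * T) 0 ∧
        (ω h = -1 → IsFeasibleTriple ω a (kernelOperators ω a hs k) h T 0) ∧
        0 ≤ optimalValue ω a (kernelOperators ω a hs k) ∧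
        ∀ h' T' μ', IsOutput ω a (kernelOperators ω a hs k) h' T' μ' → 0 ≤ μ') ∧
      -- recoverability
      (Submodule.span ℂ (Set.range b) = ⊤ →
        (∀ h' T' μ', IsOutput ω a (kernelOperators ω a hs k) h' T' μ' ↔
          h' = c⁻¹ • h ∧ T' = c⁻¹ * T ∧ μ' = 0) ∧
        (ω h = -1 → ∀ h' T' μ', IsOutput ω a (kernelOperators ω a hs k) h' T' μ' ↔
          h' = h ∧ T' = T ∧ μ' = 0)) := by
  have h_sa : IsSelfAdjoint h := by
    rw [hh]
    exact isSelfAdjoint_sum _ fun α _ => .smul (.all (y α)) (hs_sa α)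
  have h_tr : opTrace h = 0 := hh ▸ opTrace_sum_smul hs_tr y
  have : Nontrivial E := by
    by_contra hE
    rw [not_nontrivial_iff_subsingleton] at hE
    exact h_ne (Subsingleton.elim _ _)
  have hy : y ∈ wKernel ω a hs :=
    wMatrix_mulVec_eq_zero (hh ▸ gibbs_commMatrix_isHermitian h_sa hω)
  refine ⟨fun hW => h_ne ?_, ?_⟩
  · have hy0 := Matrix.mulVec_injective_of_isUnit hW
      ((show (wMatrix ω a hs).mulVec (fun α => (y α : ℂ)) = 0 from hy).trans
        (Matrix.mulVec_zero _).symm)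
    rw [hh]
    refine Finset.sum_eq_zero fun α _ => ?_
    have hα : y α = 0 := by simpa using congrFun hy0 α
    rw [hα, zero_smul]
  obtain ⟨c, hc, hωc⟩ := exists_gibbs_expectation_eq_neg h_sa h_tr h_ne hω
  have hω' : IsGibbsState ω (c⁻¹ • h) (c⁻¹ * T) := hω.smul (inv_pos.2 hc)
  have h_sa' : IsSelfAdjoint (c⁻¹ • h) := .smul (.all _) h_sa
  have hω1 : ω (c⁻¹ • h) = -1 := by
    have : (c : ℂ) ≠ 0 := by exact_mod_cast hc.ne'
    rw [← Complex.coe_smul, map_smul, hωc, smul_eq_mul]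
    push_cast
    field_simp
  have hfeas : IsFeasibleTriple ω a (kernelOperators ω a hs k) (c⁻¹ • h) (c⁻¹ * T) 0 := by
    have hsum : c⁻¹ • h =
        ∑ β, k.repr (c⁻¹ • ⟨y, hy⟩) β • kernelOperators ω a hs k β := by
      rw [sum_repr_smul_kernelOperators, hh, Finset.smul_sum]
      exact Finset.sum_congr rfl fun α _ => by simp [smul_smul]
    refine ⟨_, hsum, hω'.1.le, ?_, ?_⟩
    · rw [← commMatrix_sum_smul, ← hsum, zero_smul, sub_zero]
      exact gibbs_posSemidef h_sa' hω' ha.2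
    · rw [← map_sum_real_smul, ← hsum, hω1]
  have hscale : ω h = -1 → c = 1 := fun h1 => by
    rw [hωc] at h1
    exact_mod_cast neg_injective h1
  refine ⟨c, hc, hωc, hω', ⟨hfeas, fun h1 => ?_, ?_, ?_⟩, fun hspan => ?_⟩
  · simpa [hscale h1] using hfeas
  · obtain ⟨y₀, -, hy₀⟩ := hfeas
    exact le_sSup ⟨y₀, _, 0, hy₀, EReal.coe_zero.symm⟩
  · rintro h' T' μ' ⟨y', -, -, hmax⟩
    obtain ⟨y₀, -, hy₀⟩ := hfeas
    exact hmax y₀ _ 0 hy₀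
  have hr : r = Module.finrank ℂ E * Module.finrank ℂ E := by
    have h1 := finrank_span_eq_card hb
    rw [hspan, finrank_top, Fintype.card_fin] at h1
    rw [← h1, ← LinearMap.toContinuousLinearMap.finrank_eq (R := ℂ), Module.finrank_linearMap]
  have ht_tr : ∀ β, opTrace (kernelOperators ω a hs k β) = 0 := fun β =>
    opTrace_sum_smul hs_tr _
  have hupper : ∀ y' {T' μ'}, IsFeasible ω a (kernelOperators ω a hs k) y' T' μ' → μ' ≤ 0 ∧ _ :=
    fun y' _ _ hf => nonpos_and_eq_of_isFeasible h_sa' (by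
      simpa using opTrace_sum_smul (x := ![h]) (by simpa using h_tr) ![c⁻¹]) hω' hω1 ha.2 hr
      ht_tr hf
  have hrec : ∀ h' T' μ', IsOutput ω a (kernelOperators ω a hs k) h' T' μ' ↔
      h' = c⁻¹ • h ∧ T' = c⁻¹ * T ∧ μ' = 0 := by
    obtain ⟨y₀, hy₀, hf₀⟩ := hfeas
    refine fun h' T' μ' => ⟨?_, ?_⟩
    · rintro ⟨y', rfl, hf, hmax⟩
      obtain ⟨hle, heq⟩ := hupper y' hf
      have h0 : μ' = 0 := le_antisymm hle (hmax y₀ _ 0 hf₀)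
      exact ⟨(heq h0).1, (heq h0).2, h0⟩
    · rintro ⟨rfl, rfl, rfl⟩
      exact ⟨y₀, hy₀, hf₀, fun y' T' μ' hf => (hupper y' hf).1⟩
  exact ⟨hrec, fun h1 => by simpa [hscale h1] using hrec⟩
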